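/- Let $n\ge 1$, let $\mathbb F$ be a field, and let $V=\bigoplus_{m\in\mathbb Z/n}V_m$ be a finite-dimensional $\mathbb F$-vector space with a fixed decomposition into (possibly zero) subspaces. Write $[k]$ for the class of $k\in\mathbb Z$ in $\mathbb Z/n$. Let $K=\prod_m GL(V_m)\subset GL(V)$, and let $\mathcal N$ be the set of nilpotent $x\in\mathrm{End}(V)$ with $xV_m\subset V_{m+[1]}$ for all $m$. The group $K$ acts on $\mathcal N$ by conjugation and diagonally on $V\times\mathcal N$; write $\mathcal O_x$ and $\mathcal O_{v,x}$ for the orbits. A colored partition is a pair $(\lambda,\epsilon)$, where $\lambda=(\lambda_1\ge\lambda_2\ge\cdots)$ is a sequence of nonnegative integers that is eventually $0$, and $\epsilon:\{1,2,\dots\}\to\mathbb Z/n$ takes each value infinitely often. Its length $l(\lambda)$ is the number of $i$ with $\lambda_i>0$. Its signature assigns to $m\in\mathbb Z/n$ the number of pairs $(i,j)$ with $1\le j\le\lambda_i$ and $\epsilon_i+[\lambda_i-j]=m$; all colored partitions below are required to have signature $m\mapsto\dim V_m$. A colored Jordan basis of type $(\lambda,\epsilon)$ for $x\in\mathcal N$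 is a basis $\{v_{i,j}\mid 1\le j\le\lambda_i\}$ of $V$ with $v_{i,j}\in V_{\epsilon_i+[\lambda_i-j]}$, $xv_{i,j}=v_{i,j-1}$ for $j>1$, and $xv_{i,1}=0$. The $x\in\mathcal N$ that have such a basis form a single $K$-orbit $\mathcal O_{\lambda,\epsilon}$. A marking of $\lambda$ is a function $\mu:\{1,2,\dots\}\to\mathbb Z$ with $\mu_i\le\lambda_i$ for all $i$; markings are ordered pointwise. Put $\Psi(\lambda,\epsilon,\mu)=\mathcal O_{v,x}$, where $x\in\mathcal N$ has a colored Jordan basis $\{v_{i,j}\}$ of type $(\lambda,\epsilon)$ and $v=\sum_{i=1}^{l(\lambda)}v_{i,\mu_i}$ (with $v_{i,j}=0$ for $j\le 0$); this does not depend on the choices. The triples $(\lambda,\epsilon,\mu)$ and $(\alpha,\beta,\gamma)$ are row-equivalent if there is a permutation $\sigma$ of $\{1,2,\dots\}$ with $\alpha=\lambda\circ\sigma$, $\beta=\epsilon\circ\sigma$, $\gamma=\mu\circ\sigma$. **Theorem.** Let $\mathcal O\in K\backslash(V\times\mathcal N)$ be in the image of $\Psi$, and let $(\lambda,\epsilon)$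 be a corresponding colored partition, that is, $x\in\mathcal O_{\lambda,\epsilon}$ for $(v,x)\in\mathcal O$. Let $S_{\mathcal O}$ be the set of markings $\mu$ of $\lambda$ with $\mu\ge 0$ and $\Psi(\lambda,\epsilon,\mu)=\mathcal O$, and call $\mu\in S_{\mathcal O}$ minimal if $\delta\in S_{\mathcal O}$ and $\delta\le\mu$ imply $\delta=\mu$. Then: 1. There is a minimal $\mu\in S_{\mathcal O}$. 2. For each $\mu\in S_{\mathcal O}$ there is a minimal $\delta\in S_{\mathcal O}$ with $\delta\le\mu$. 3. If $\mu,\delta\in S_{\mathcal O}$ are both minimal, then $(\lambda,\epsilon,\mu)$ and $(\lambda,\epsilon,\delta)$ are row-equivalent. 4. An element $\mu\in S_{\mathcal O}$ is minimal if and only if $\mu_i>\mu_j$ and $\lambda_i-\mu_i>\lambda_j-\mu_j$ for every pair $i<j$ with $\mu_i>0$, $\mu_j>0$ and $\epsilon_j+[\lambda_j-\mu_j]=\epsilon_i+[\lambda_i-\mu_i]$. -/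

import Mathlib

namespace ColoredCone

/-! ### Colored partitions, markings, row equivalence -/

/-- An `n`-colored partition `(λ, ε)`.  Rows are indexed from `0` instead of `1`. -/
structure ColoredPartition (n : ℕ) where
  /-- row lengths `λ_i` -/
  len : ℕ → ℕ
  len_antitone : Antitone len
  exists_len_eq_zero : ∃ i, len i = 0
  /-- row colors `ε_i` -/
  color : ℕ → ZMod n
  infinite_color : ∀ m : ZMod n, {i | color i = m}.Infinite

namespace ColoredPartition

variable {n : ℕ} (P : ColoredPartition n)

/-- The length `l(λ)`: the number of nonzero rows. -/
noncomputable def length : ℕ := {i | 0 < P.len i}.ncard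

/-- The boxes `(i, j)`, `1 ≤ j ≤ λ_i`, of the Young diagram (columns are indexed from `1`). -/
abbrev Box : Type := {p : ℕ × ℕ // 1 ≤ p.2 ∧ p.2 ≤ P.len p.1}

/-- The color `ε_i + [λ_i - j]` of the box `(i, j)`. -/
def boxColor (p : P.Box) : ZMod n :=
  P.color p.1.1 + (((P.len p.1.1 : ℤ) - (p.1.2 : ℤ) : ℤ) : ZMod n)

/-- The signature `ξ(λ, ε)`: the number of boxes of each color. -/
noncomputable def signature (m : ZMod n) : ℕ := Nat.card {p : P.Box // P.boxColor p = m}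

/-- A marking of `λ`: a function `μ` with integer values and `μ_i ≤ λ_i` for each `i`.
Markings are ordered pointwise. -/
def Marking : Type := {μ : ℕ → ℤ // ∀ i, μ i ≤ (P.len i : ℤ)}

instance : PartialOrder P.Marking :=
  inferInstanceAs (PartialOrder {μ : ℕ → ℤ // ∀ i, μ i ≤ (P.len i : ℤ)})

instance : CoeFun P.Marking (fun _ => ℕ → ℤ) := ⟨fun μ => μ.1⟩

/-- The color `ε_i + [λ_i - μ_i]` attached to the mark in row `i`. -/
def markColor (μ : P.Marking) (i : ℕ) : ZMod n :=
  P.color i + (((P.len i : ℤ) - μ i : ℤ) : ZMod n)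

instance : Finite P.Box := by
  obtain ⟨N, hN⟩ := P.exists_len_eq_zero
  have hfin : ((Set.Iio N) ×ˢ (Set.Iic (P.len 0)) : Set (ℕ × ℕ)).Finite :=
    (Set.finite_Iio N).prod (Set.finite_Iic _)
  have hsub : {p : ℕ × ℕ | 1 ≤ p.2 ∧ p.2 ≤ P.len p.1} ⊆ (Set.Iio N) ×ˢ (Set.Iic (P.len 0)) := by
    rintro ⟨i, j⟩ ⟨h1, h2⟩
    have h3 : P.len i ≤ P.len 0 := P.len_antitone (Nat.zero_le i)
    refine ⟨?_, h2.trans h3⟩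
    by_contra hi
    have h4 : P.len i ≤ P.len N := P.len_antitone (not_lt.mp hi)
    dsimp only at h1 h2
    omega
  exact (hfin.subset hsub).to_subtype

end ColoredPartition

/-- Row equivalence of marked colored partitions `(λ, ε, μ)` and `(α, β, γ)`: one is obtained from
the other by permuting rows, together with their colors and marks. -/
def RowEquivalent {n : ℕ} (P Q : ColoredPartition n) (μ : P.Marking) (γ : Q.Marking) : Prop :=
  ∃ σ : Equiv.Perm ℕ, ∀ i, Q.len i = P.len (σ i) ∧ Q.color i = P.color (σ i) ∧ γ i = μ (σ i)

/-! ### Colored vector spaces, the group `K` and the colored nilpotent cone -/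

section Spaces

variable {n : ℕ} {F V : Type*} [Field F] [AddCommGroup V] [Module F V]
variable (C : ZMod n → Submodule F V)

/-- The signature `ξ(V)` of the colored space `V = ⨁ V_m`, where `V_m = C m`. -/
noncomputable def spaceSignature (m : ZMod n) : ℕ := Module.finrank F (C m)

/-- The group `K = ∏ GL(V_m)`, as the subgroup of `GL(V)` preserving each `V_m`. -/
def colorGroup : Subgroup (V ≃ₗ[F] V) where
  carrier := {g | ∀ m v, g v ∈ C m ↔ v ∈ C m}
  one_mem' := fun _ _ => Iff.rfl
  mul_mem' := fun {g h} hg hh m v => (hg m (h v)).trans (hh m v)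
  inv_mem' := fun {g} hg m v => by
    rw [← hg m (g⁻¹ v)]
    exact iff_of_eq (congrArg (· ∈ C m) (g.apply_symm_apply v))

/-- The colored nilpotent cone: nilpotent `x` with `x V_m ⊆ V_{m+1}` for each color `m`. -/
def NilCone : Type _ :=
  {x : Module.End F V // IsNilpotent x ∧ ∀ m, ∀ v ∈ C m, x v ∈ C (m + 1)}

theorem conj_mem_nilCone (g : colorGroup C) (x : NilCone C) :
    IsNilpotent (g.1.conj x.1) ∧ ∀ m, ∀ v ∈ C m, (g.1.conj x.1) v ∈ C (m + 1) := by
  refine ⟨?_, fun m v hv => ?_⟩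
  · obtain ⟨k, hk⟩ := x.2.1
    refine ⟨k, ?_⟩
    have : ∀ k : ℕ, (g.1.conj x.1) ^ k = g.1.conj (x.1 ^ k) := fun k =>
      (map_pow (g.1.conjAlgEquiv F) x.1 k).symm
    rw [this, hk, map_zero]
  · rw [LinearEquiv.conj_apply_apply]
    refine (g.2 _ _).2 (x.2.2 m _ ?_)
    exact (g⁻¹).2 m v |>.2 hv

/-- `K` acts on the colored nilpotent cone by conjugation, `g • x = g x g⁻¹`.  Together with the
natural action on `V` this gives the diagonal action on `V × NilCone C`. -/
instance : MulAction (colorGroup C) (NilCone C) where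
  smul g x := ⟨g.1.conj x.1, conj_mem_nilCone C g x⟩
  one_smul _ := Subtype.ext (LinearMap.ext fun _ => rfl)
  mul_smul _ _ _ := Subtype.ext (LinearMap.ext fun _ => rfl)

/-- The set `K \ N` of orbits in the colored nilpotent cone. -/
abbrev NilOrbit : Type _ := MulAction.orbitRel.Quotient (colorGroup C) (NilCone C)

/-- The set `K \ (V × N)` of enhanced orbits. -/
abbrev EnhOrbit : Type _ := MulAction.orbitRel.Quotient (colorGroup C) (V × NilCone C)

/-- The orbit `O_x = K · x`. -/
def nilOrbitOf (x : NilCone C) : NilOrbit C := Quotient.mk _ x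

/-- The orbit `O_{v,x} = K · (v, x)`. -/
def enhOrbitOf (v : V) (x : NilCone C) : EnhOrbit C := Quotient.mk _ (v, x)

/-! ### Bases of type `(λ, ε)` and colored Jordan bases -/

variable {C}

/-- `v_{i,j}` for an arbitrary integer `j`, with value `0` outside of the diagram. -/
noncomputable def extBasis {P : ColoredPartition n} (b : Module.Basis P.Box F V)
    (i : ℕ) (j : ℤ) : V :=
  if h : 1 ≤ j.toNat ∧ j.toNat ≤ P.len i then b ⟨(i, j.toNat), h⟩ else 0

variable (C) in
/-- The labeled basis `v_{i,j}` of `V` is of type `(λ, ε)`: the basis vector `v_{i,j}` has color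
`ε_i + [λ_i - j]`. -/
def IsOfType {P : ColoredPartition n} (b : Module.Basis P.Box F V) : Prop :=
  ∀ p, b p ∈ C (P.boxColor p)

/-- The labeled basis `v_{i,j}` is a Jordan basis for `x`: `x v_{i,j} = v_{i,j-1}` for `j > 1`, and
`x v_{i,1} = 0`. -/
def IsJordanFor {P : ColoredPartition n} (b : Module.Basis P.Box F V) (x : NilCone C) : Prop :=
  ∀ p : P.Box, x.1 (b p) = extBasis b p.1.1 ((p.1.2 : ℤ) - 1)

/-- The vector `∑_{i = 1}^{l(λ)} v_{i, μ_i}`. -/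
noncomputable def markedVector {P : ColoredPartition n} (b : Module.Basis P.Box F V)
    (μ : P.Marking) : V :=
  ∑ i ∈ Finset.range P.length, extBasis b i (μ i)

theorem extBasis_eq {P : ColoredPartition n} (b : Module.Basis P.Box F V) (p : P.Box) :
    extBasis b p.1.1 (p.1.2 : ℤ) = b p := by
  have h : 1 ≤ ((p.1.2 : ℤ)).toNat ∧ ((p.1.2 : ℤ)).toNat ≤ P.len p.1.1 := by
    simpa using p.2
  rw [extBasis, dif_pos h]
  congr 1

/-- If the signatures agree then there is a basis of type `(λ, ε)`. -/
theorem exists_isOfType [NeZero n] [FiniteDimensional F V] (hC : DirectSum.IsInternal C)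
    (P : ColoredPartition n) (hP : P.signature = spaceSignature C) :
    ∃ b : Module.Basis P.Box F V, IsOfType C b := by
  classical
  let e : ∀ m, {p : P.Box // P.boxColor p = m} ≃ Fin (Module.finrank F (C m)) := fun m =>
    Finite.equivFinOfCardEq (congrFun hP m)
  let B := hC.collectedBasis (fun m => (Module.finBasis F (C m)).reindex (e m).symm)
  refine ⟨B.reindex (Equiv.sigmaFiberEquiv P.boxColor), fun p => ?_⟩
  rw [Module.Basis.reindex_apply]
  exact hC.collectedBasis_mem (fun m => (Module.finBasis F (C m)).reindex (e m).symm)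
    ((Equiv.sigmaFiberEquiv P.boxColor).symm p)

theorem color_eq_span {P : ColoredPartition n} {b : Module.Basis P.Box F V}
    (hP : P.signature = spaceSignature C) (hb : IsOfType C b) (m : ZMod n) :
    Submodule.span F (Set.range fun p : {p : P.Box // P.boxColor p = m} => b p.1) = C m := by
  classical
  have : Fintype {p : P.Box // P.boxColor p = m} := Fintype.ofFinite _
  have : FiniteDimensional F V := Module.Finite.of_basis b
  refine Submodule.eq_of_le_of_finrank_eq ?_ ?_
  · rw [Submodule.span_le]
    rintro _ ⟨⟨p, rfl⟩, rfl⟩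
    exact hb p
  · have hli : LinearIndependent F fun p : {p : P.Box // P.boxColor p = m} => b p.1 :=
      b.linearIndependent.comp _ Subtype.val_injective
    rw [finrank_span_eq_card hli, ← Nat.card_eq_fintype_card]
    exact congrFun hP m

theorem extBasis_sub_one_mem {P : ColoredPartition n} {b : Module.Basis P.Box F V}
    (hb : IsOfType C b) (p : P.Box) :
    extBasis b p.1.1 ((p.1.2 : ℤ) - 1) ∈ C (P.boxColor p + 1) := by
  rw [extBasis]
  split_ifs with h
  · convert hb ⟨(p.1.1, ((p.1.2 : ℤ) - 1).toNat), h⟩ using 2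
    have h1 := p.2.1
    have h2 : ((((p.1.2 : ℤ) - 1).toNat : ℕ) : ℤ) = (p.1.2 : ℤ) - 1 := by omega
    simp only [ColoredPartition.boxColor, h2]
    push_cast
    ring
  · exact zero_mem _

theorem pow_apply_extBasis {P : ColoredPartition n} {b : Module.Basis P.Box F V}
    {x : Module.End F V} (hx : ∀ p : P.Box, x (b p) = extBasis b p.1.1 ((p.1.2 : ℤ) - 1))
    (p : P.Box) (k : ℕ) : (x ^ k) (b p) = extBasis b p.1.1 ((p.1.2 : ℤ) - k) := by
  induction k with
  | zero => simpa using (extBasis_eq b p).symm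
  | succ k ih =>
    rw [pow_succ', Module.End.mul_apply, ih]
    have h1 := p.2.1
    have h2 := p.2.2
    rw [extBasis]
    split_ifs with h
    · rw [hx]
      congr 1
      push_cast
      omega
    · rw [map_zero, extBasis, dif_neg]
      push_cast
      omega

/-- Each basis of type `(λ, ε)` is a colored Jordan basis for some `x` in the cone. -/
theorem exists_isJordanFor {P : ColoredPartition n} {b : Module.Basis P.Box F V}
    (hP : P.signature = spaceSignature C) (hb : IsOfType C b) :
    ∃ x : NilCone C, IsJordanFor b x := by
  let x : Module.End F V := b.constr F fun p => extBasis b p.1.1 ((p.1.2 : ℤ) - 1)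
  have hx : ∀ p : P.Box, x (b p) = extBasis b p.1.1 ((p.1.2 : ℤ) - 1) := fun p =>
    b.constr_basis F _ p
  refine ⟨⟨x, ⟨P.len 0, b.ext fun p => ?_⟩, fun m v hv => ?_⟩, hx⟩
  · rw [pow_apply_extBasis hx, extBasis, dif_neg, LinearMap.zero_apply]
    have h1 := p.2.2
    have h2 : P.len p.1.1 ≤ P.len 0 := P.len_antitone (Nat.zero_le _)
    omega
  · rw [← color_eq_span hP hb m] at hv
    induction hv using Submodule.span_induction with
    | mem y hy =>
      obtain ⟨⟨p, rfl⟩, rfl⟩ := hy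
      change x (b p) ∈ _
      rw [hx]
      exact extBasis_sub_one_mem hb p
    | zero => rw [map_zero]; exact zero_mem _
    | add y z _ _ hy hz => rw [map_add]; exact add_mem hy hz
    | smul a y _ hy => rw [map_smul]; exact Submodule.smul_mem _ a hy

/-- If the signatures agree then some `x` in the cone has a colored Jordan basis of
type `(λ, ε)`. -/
theorem exists_typedJordan [NeZero n] [FiniteDimensional F V] (hC : DirectSum.IsInternal C)
    (P : ColoredPartition n) (hP : P.signature = spaceSignature C) :
    ∃ d : Module.Basis P.Box F V × NilCone C, IsOfType C d.1 ∧ IsJordanFor d.1 d.2 := by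
  obtain ⟨b, hb⟩ := exists_isOfType hC P hP
  obtain ⟨x, hx⟩ := exists_isJordanFor hP hb
  exact ⟨(b, x), hb, hx⟩

/-! ### The orbits `O_{λ,ε}` and `Ψ(λ, ε, μ)` -/

/-- The orbit `O_{λ,ε}` of those `x` that have a colored Jordan basis of type `(λ, ε)`; one such
`x` is chosen, and `shapeOrbit_eq` says that the choice does not matter. -/
noncomputable def shapeOrbit [NeZero n] [FiniteDimensional F V] (hC : DirectSum.IsInternal C)
    (P : ColoredPartition n) (hP : P.signature = spaceSignature C) : NilOrbit C :=
  nilOrbitOf C (exists_typedJordan hC P hP).choose.2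

/-- `Ψ(λ, ε, μ)`, the orbit of `(∑ v_{i,μ_i}, x)`, where `v_{i,j}` is a colored Jordan basis for `x`
of type `(λ, ε)`; one such pair is chosen, and `Psi_eq` says that the choice does not matter. -/
noncomputable def Psi [NeZero n] [FiniteDimensional F V] (hC : DirectSum.IsInternal C)
    (P : ColoredPartition n) (hP : P.signature = spaceSignature C) (μ : P.Marking) : EnhOrbit C :=
  enhOrbitOf C (markedVector (exists_typedJordan hC P hP).choose.1 μ)
    (exists_typedJordan hC P hP).choose.2

/-- The map `K \ (V × N) → K \ N` induced by the projection `V × N → N`. -/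
def projOrbit (O : EnhOrbit C) : NilOrbit C :=
  Quotient.map' (s₁ := MulAction.orbitRel (colorGroup C) (V × NilCone C))
    (s₂ := MulAction.orbitRel (colorGroup C) (NilCone C)) Prod.snd
    (by rintro _ b ⟨g, rfl⟩; exact ⟨g, rfl⟩) O

theorem exists_transport {P : ColoredPartition n} (hP : P.signature = spaceSignature C)
    {b b' : Module.Basis P.Box F V} {x x' : NilCone C} (hb : IsOfType C b) (hx : IsJordanFor b x)
    (hb' : IsOfType C b') (hx' : IsJordanFor b' x') :
    ∃ g : colorGroup C, g • x = x' ∧ ∀ μ : P.Marking, g • markedVector b μ = markedVector b' μ := by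
  have key : ∀ {b b' : Module.Basis P.Box F V}, IsOfType C b → IsOfType C b' → ∀ m v, v ∈ C m →
      b.equiv b' (Equiv.refl _) v ∈ C m := by
    intro b b' hb hb' m v hv
    rw [← color_eq_span hP hb m] at hv
    induction hv using Submodule.span_induction with
    | mem y hy =>
      obtain ⟨⟨p, rfl⟩, rfl⟩ := hy
      simpa using hb' p
    | zero => rw [map_zero]; exact zero_mem _
    | add y z _ _ hy hz => rw [map_add]; exact add_mem hy hz
    | smul a y _ hy => rw [map_smul]; exact Submodule.smul_mem _ a hy
  let g : V ≃ₗ[F] V := b.equiv b' (Equiv.refl _)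
  have hext : ∀ i j, g (extBasis b i j) = extBasis b' i j := by
    intro i j
    rw [extBasis, extBasis]
    split_ifs with h
    · simp [g]
    · exact map_zero g
  have hg : g ∈ colorGroup C := fun m v => by
    refine ⟨fun h => ?_, key hb hb' m v⟩
    have h2 := key hb' hb m _ h
    have h3 : b'.equiv b (Equiv.refl _) = g.symm := by
      simp only [g, Module.Basis.equiv_symm, Equiv.refl_symm]
    rwa [h3, g.symm_apply_apply] at h2
  refine ⟨⟨g, hg⟩, Subtype.ext (b'.ext fun p => ?_), fun μ => ?_⟩
  · have h1 : g.symm (b' p) = b p := by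
      rw [LinearEquiv.symm_apply_eq]; simp [g]
    change g (x.1 (g.symm (b' p))) = x'.1 (b' p)
    rw [h1, hx, hx', hext]
  · change g (markedVector b μ) = _
    rw [markedVector, map_sum]
    exact Finset.sum_congr rfl fun i _ => hext i _

theorem shapeOrbit_eq [NeZero n] [FiniteDimensional F V] (hC : DirectSum.IsInternal C)
    {P : ColoredPartition n} (hP : P.signature = spaceSignature C)
    {b : Module.Basis P.Box F V} {x : NilCone C} (hb : IsOfType C b) (hx : IsJordanFor b x) :
    shapeOrbit hC P hP = nilOrbitOf C x := by
  obtain ⟨hb', hx'⟩ := (exists_typedJordan hC P hP).choose_spec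
  obtain ⟨g, hg, -⟩ := exists_transport hP hb hx hb' hx'
  exact Quotient.sound ⟨g, hg⟩

theorem Psi_eq [NeZero n] [FiniteDimensional F V] (hC : DirectSum.IsInternal C)
    {P : ColoredPartition n} (hP : P.signature = spaceSignature C) (μ : P.Marking)
    {b : Module.Basis P.Box F V} {x : NilCone C} (hb : IsOfType C b) (hx : IsJordanFor b x) :
    Psi hC P hP μ = enhOrbitOf C (markedVector b μ) x := by
  obtain ⟨hb', hx'⟩ := (exists_typedJordan hC P hP).choose_spec
  obtain ⟨g, hg, hv⟩ := exists_transport hP hb hx hb' hx'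
  exact Quotient.sound ⟨g, Prod.ext (hv μ) hg⟩

/-- The image of `Ψ`: the orbits `Ψ(α, β, γ)` for all marked colored partitions `(α, β, γ)` of
signature `ξ(V)`. -/
def psiImage [NeZero n] [FiniteDimensional F V] (hC : DirectSum.IsInternal C) :
    Set (EnhOrbit C) :=
  {O | ∃ (Q : ColoredPartition n) (hQ : Q.signature = spaceSignature C) (γ : Q.Marking),
    Psi hC Q hQ γ = O}

/-- The set `S_O` of nonnegative markings `μ` of `λ` with `Ψ(λ, ε, μ) = O`. -/
def markingsOf [NeZero n] [FiniteDimensional F V] (hC : DirectSum.IsInternal C)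
    (P : ColoredPartition n) (hP : P.signature = spaceSignature C) (O : EnhOrbit C) :
    Set P.Marking :=
  {μ | Psi hC P hP μ = O ∧ ∀ i, 0 ≤ μ i}

/-- `μ` is a minimal marking for `O`: `μ ∈ S_O`, and `δ = μ` for each `δ ∈ S_O` with `δ ≤ μ`. -/
def IsMinimalMarking [NeZero n] [FiniteDimensional F V] (hC : DirectSum.IsInternal C)
    (P : ColoredPartition n) (hP : P.signature = spaceSignature C) (O : EnhOrbit C)
    (μ : P.Marking) : Prop :=
  μ ∈ markingsOf hC P hP O ∧ ∀ δ ∈ markingsOf hC P hP O, δ ≤ μ → δ = μ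

end Spaces

end ColoredCone

/-!
Let `v_{i,j}` be a colored Jordan basis for `x`, and say that the mark `μ_i` dominates the mark
`μ_j` if the two have the same color, `μ_j ≤ μ_i` and `λ_i - μ_i ≤ λ_j - μ_j`.  In that case adding
row `j`, suitably shifted, to row `i` gives another colored Jordan basis for `x`, in which
`v_{i,μ_i}` stands for the former `v_{i,μ_i} + v_{j,μ_j}`; hence the mark in row `j` can be deleted
without changing the orbit.  So no positive mark of a minimal marking dominates another one, and
since `λ` is decreasing this is the strictness condition in the fourth assertion.

For the converse, each subspace `ker x^k ∩ im x^s ∩ V_m` is spanned by those vectors that it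
contains from any given colored Jordan basis.  Their dimensions count the rows of given length and
color, so `x` determines `(λ, ε)` up to a permutation of the rows.  Moreover, if
`∑ v_{i,μ_i} = ∑ w_{j,δ_j}` for two colored Jordan bases `v` and `w` for `x`, then expanding the
right-hand side in the basis `v` shows that every positive mark of `μ` is dominated by a mark of
`δ`, and conversely.  If `μ` is strict, going from `μ` to `δ` and back must return to the same
mark, so each positive mark of `μ` occurs in `δ` in a row of the same length and color.  Two strict
markings with the same orbit are therefore row-equivalent, and a strict `μ` is minimal because
`δ ≤ μ` then forces `δ = μ`.
-/

namespace ColoredCone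

/-! ### Strict markings -/

namespace ColoredPartition

variable {n : ℕ} {P Q : ColoredPartition n}

theorem lt_length_iff {i : ℕ} : i < P.length ↔ 0 < P.len i := by
  have hset : {i | 0 < P.len i} = Set.Iio (Nat.find P.exists_len_eq_zero) := by
    ext j
    refine ⟨fun hj => ?_, fun hj => Nat.pos_of_ne_zero (Nat.find_min P.exists_len_eq_zero hj)⟩
    by_contra hlt
    have hle := P.len_antitone (not_lt.mp hlt)
    rw [Nat.find_spec P.exists_len_eq_zero] at hle
    exact hle.not_gt hj
  rw [length, hset, Set.ncard_Iio_nat, ← Set.mem_Iio, ← hset, Set.mem_ofPred_eq]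

theorem finite_setOf_len_pos : {i | 0 < P.len i}.Finite :=
  (Set.finite_Iio P.length).subset fun _ => lt_length_iff.mpr

/-- The type `(λ_i, ε_i)` of a row: the data of a row that does not depend on its position. -/
def rowType (P : ColoredPartition n) (i : ℕ) : ℕ × ZMod n := (P.len i, P.color i)

theorem finite_setOf_rowType_eq {r : ℕ × ZMod n} (hr : r.1 ≠ 0) : {i | P.rowType i = r}.Finite :=
  finite_setOf_len_pos.subset <| by
    rintro i rfl
    exact Nat.pos_of_ne_zero hr

theorem infinite_setOf_rowType_eq_zero (c : ZMod n) : {i | P.rowType i = (0, c)}.Infinite :=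
  ((P.infinite_color c).sdiff finite_setOf_len_pos).mono fun _ hi =>
    Prod.ext (Nat.eq_zero_of_not_pos hi.2) hi.1

theorem exists_perm_rowType_eq
    (h : ∀ r : ℕ × ZMod n, r.1 ≠ 0 → {i | P.rowType i = r}.ncard = {i | Q.rowType i = r}.ncard) :
    ∃ σ : Equiv.Perm ℕ, ∀ i, P.rowType (σ i) = Q.rowType i := by
  have fiberEquiv : ∀ r, Nonempty ({i // Q.rowType i = r} ≃ {i // P.rowType i = r}) := by
    intro r
    by_cases hr : r.1 = 0
    · obtain ⟨_, c⟩ := r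
      obtain rfl := hr
      have := (infinite_setOf_rowType_eq_zero (P := P) c).to_subtype
      have := (infinite_setOf_rowType_eq_zero (P := Q) c).to_subtype
      exact nonempty_equiv_of_countable (α := {i | Q.rowType i = (0, c)})
        (β := {i | P.rowType i = (0, c)})
    · have := (finite_setOf_rowType_eq (P := P) hr).to_subtype
      have := (finite_setOf_rowType_eq (P := Q) hr).to_subtype
      exact (Finite.card_eq (α := {i | Q.rowType i = r}) (β := {i | P.rowType i = r})).mp
        (h r hr).symm
  exact ⟨Equiv.ofFiberEquiv fun r => (fiberEquiv r).some, Equiv.ofFiberEquiv_map _⟩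

namespace Marking

variable {μ δ : P.Marking} {i j : ℕ}

theorem lt_length (h : 0 < μ i) : i < P.length :=
  lt_length_iff.mpr (by have := μ.2 i; omega)

theorem eq_zero_of_length_le (h : 0 ≤ μ i) (hi : P.length ≤ i) : μ i = 0 :=
  h.eq_or_lt.elim Eq.symm fun h => absurd (lt_length h) hi.not_gt

theorem finite_setOf_nonneg : {μ : P.Marking | ∀ i, 0 ≤ μ i}.Finite := by
  refine Set.Finite.of_injOn (f := fun (μ : P.Marking) (i : Fin P.length) => μ i)
    (t := Set.Icc 0 fun i => (P.len i : ℤ)) (fun μ hμ => ⟨fun i => hμ i, fun i => μ.2 i⟩)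
    (fun μ hμ δ hδ h => Subtype.ext (funext fun i => ?_)) (Set.finite_Icc _ _)
  rcases lt_or_ge i P.length with hi | hi
  · exact congrFun h ⟨i, hi⟩
  · exact (eq_zero_of_length_le (hμ i) hi).trans (eq_zero_of_length_le (hδ i) hi).symm

/-- The marking obtained by deleting the mark in row `j`, that is, by moving it to column `0`. -/
def erase (μ : P.Marking) (j : ℕ) : P.Marking :=
  ⟨fun i => if i = j then 0 else μ i, fun i => by
    dsimp only
    split_ifs
    · positivity
    · exact μ.2 i⟩

theorem erase_apply (μ : P.Marking) (j i : ℕ) : μ.erase j i = if i = j then 0 else μ i := rfl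

/-- The marking obtained by moving all marks in nonpositive columns to column `0`. -/
def posPart (μ : P.Marking) : P.Marking :=
  ⟨fun i => max (μ i) 0, fun i => max_le (μ.2 i) (by positivity)⟩

/-- The mark of `δ` in row `j` dominates the mark of `μ` in row `i`: it has the same color, its
column is at least as large, and at most as many boxes follow it in its row.  For positive marks
this says that an endomorphism of the colored space commuting with `x` can carry `v_{j,δ_j}` to a
vector with a nonzero coefficient at `v_{i,μ_i}`. -/
def Dominates (δ : Q.Marking) (j : ℕ) (μ : P.Marking) (i : ℕ) : Prop :=
  Q.markColor δ j = P.markColor μ i ∧ μ i ≤ δ j ∧ (Q.len j : ℤ) - δ j ≤ (P.len i : ℤ) - μ i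

theorem Dominates.trans {R : ColoredPartition n} {δ : Q.Marking} {ν : R.Marking} {k : ℕ}
    (h : ν.Dominates k δ j) (h' : δ.Dominates j μ i) : ν.Dominates k μ i :=
  ⟨h.1.trans h'.1, h'.2.1.trans h.2.1, h.2.2.trans h'.2.2⟩

theorem Dominates.rowType_eq_and_eq {δ : Q.Marking} (h : δ.Dominates j μ i)
    (h' : μ.Dominates i δ j) : Q.rowType j = P.rowType i ∧ δ j = μ i := by
  obtain ⟨hc, hle, hlen⟩ := h
  obtain ⟨-, hle', hlen'⟩ := h'
  have hδ : δ j = μ i := by omega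
  have hl : Q.len j = P.len i := by omega
  exact ⟨Prod.ext hl (by
    simpa only [rowType, markColor, hl, hδ, add_left_inj] using hc), hδ⟩

/-- The positive marks of each color are strictly nested: further down, both the column of the mark
and the number of boxes following it strictly decrease. -/
def IsStrict (μ : P.Marking) : Prop :=
  ∀ i j : ℕ, i < j → 0 < μ i → 0 < μ j → P.markColor μ j = P.markColor μ i →
    μ j < μ i ∧ (P.len j : ℤ) - μ j < (P.len i : ℤ) - μ i

theorem IsStrict.eq_of_dominates (hμ : μ.IsStrict) (hi : 0 < μ i) (h : μ.Dominates j μ i) :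
    i = j := by
  obtain ⟨hc, hle, hlen⟩ := h
  rcases lt_trichotomy i j with hij | hij | hij
  · have := hμ i j hij hi (by omega) hc
    omega
  · exact hij
  · have := hμ j i hij (by omega) hi hc.symm
    omega

theorem IsStrict.eq_of_rowType_eq (hμ : μ.IsStrict) (hi : 0 < μ i)
    (hrow : P.rowType i = P.rowType j) (hij : μ i = μ j) : i = j := by
  obtain ⟨hl, hc⟩ := Prod.ext_iff.mp hrow
  dsimp only [rowType] at hl hc
  exact hμ.eq_of_dominates hi
    ⟨by simp only [markColor, hl, hc, hij], hij.le, by rw [hl, hij]⟩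

theorem isStrict_of_forall_dominates
    (h : ∀ i j, 0 < μ i → 0 < μ j → μ.Dominates i μ j → i = j) : μ.IsStrict := by
  intro i j hij hi hj hc
  have hlen := P.len_antitone hij.le
  have hlt : μ j < μ i := by
    by_contra! hle
    exact hij.ne' (h j i hj hi ⟨hc, hle, by omega⟩)
  refine ⟨hlt, ?_⟩
  by_contra! hle
  exact hij.ne (h i j hi hj ⟨hc.symm, hlt.le, hle⟩)

/-- Each positive mark of `μ` occurs in `δ`, in a row of the same type. -/
def OccursIn (μ : P.Marking) (δ : Q.Marking) : Prop :=
  ∀ i, 0 < μ i → ∃ j, Q.rowType j = P.rowType i ∧ δ j = μ i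

-- If `δ_j = μ_i` in a row of the same type, then either `j = i` or `μ_j > μ_i`: induct downwards
-- on the column of the mark.
theorem OccursIn.eq_of_le (h : μ.OccursIn δ) (hμ : μ.IsStrict) (hδ : ∀ i, 0 ≤ δ i) (hle : δ ≤ μ) :
    δ = μ := by
  have eq_of_pos : ∀ (k : ℕ) (i : ℕ), P.len i - μ i < k → 0 < μ i → δ i = μ i := by
    intro k
    induction k with
    | zero => intro i hk; have := μ.2 i; omega
    | succ k ih =>
      intro i hk hi
      obtain ⟨j, hrow, hj⟩ := h i hi
      have hji : μ i ≤ μ j := hj ▸ hle j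
      rcases hji.eq_or_lt with heq | hlt
      · rwa [← hμ.eq_of_rowType_eq hi hrow.symm heq] at hj
      · have hlen : P.len j = P.len i := congrArg Prod.fst hrow
        have := ih j (by omega) (by omega)
        omega
  refine Subtype.ext (funext fun i => ?_)
  rcases lt_or_ge 0 (μ i) with hi | hi
  · exact eq_of_pos ((P.len i - μ i).toNat + 1) i (by omega) hi
  · exact le_antisymm (hle i) (hi.trans (hδ i))

end Marking

end ColoredPartition

theorem exists_perm_comp_eq_of_injOn_support {α β : Type*} [Finite α] [Zero β] {f g : α → β}
    (hf : Set.InjOn f f.support) (hg : Set.InjOn g g.support)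
    (h : f '' f.support = g '' g.support) : ∃ σ : Equiv.Perm α, ∀ a, f (σ a) = g a := by
  classical
  let := Fintype.ofFinite α
  let e : {a // g a ≠ 0} ≃ {a // f a ≠ 0} :=
    (hg.bijOn_image.equiv g).trans ((Equiv.setCongr h.symm).trans (hf.bijOn_image.equiv f).symm)
  have he : ∀ a, f (e a) = g a := fun a =>
    congrArg Subtype.val ((hf.bijOn_image.equiv f).apply_symm_apply _)
  refine ⟨e.extendSubtype, fun a => ?_⟩
  by_cases ha : g a = 0
  · rw [ha]
    exact not_not.mp (e.extendSubtype_not_mem a (not_not.mpr ha))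
  · rw [e.extendSubtype_apply_of_mem a ha]
    exact he ⟨a, ha⟩

namespace ColoredPartition.Marking

variable {n : ℕ} {P : ColoredPartition n} {μ δ : P.Marking}

theorem IsStrict.rowEquivalent (hμ : μ.IsStrict) (hδ : δ.IsStrict) (hμ0 : ∀ i, 0 ≤ μ i)
    (hδ0 : ∀ i, 0 ≤ δ i) (hμδ : μ.OccursIn δ) (hδμ : δ.OccursIn μ) : RowEquivalent P P μ δ := by
  have pos : ∀ {ν : P.Marking}, (∀ i, 0 ≤ ν i) → ∀ {i}, ν i ≠ 0 → 0 < ν i := fun h _ hi =>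
    (h _).lt_of_ne' hi
  have fiberPerm : ∀ r, ∃ τ : Equiv.Perm {i // P.rowType i = r}, ∀ i, μ (τ i) = δ i := by
    intro r
    by_cases hr : r.1 = 0
    · refine ⟨Equiv.refl _, ?_⟩
      rintro ⟨i, rfl⟩
      have hi : P.length ≤ i := not_lt.mp fun h => (lt_length_iff.mp h).ne' hr
      exact (eq_zero_of_length_le (hμ0 i) hi).trans (eq_zero_of_length_le (hδ0 i) hi).symm
    · have : Finite {i // P.rowType i = r} := (finite_setOf_rowType_eq hr).to_subtype
      have injOn : ∀ {ν : P.Marking}, ν.IsStrict → (∀ i, 0 ≤ ν i) →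
          Set.InjOn (fun i : {i // P.rowType i = r} => ν i) (Function.support fun i => ν i) :=
        fun h h0 i hi j _ hij =>
          Subtype.ext (h.eq_of_rowType_eq (pos h0 hi) (i.2.trans j.2.symm) hij)
      have image_subset : ∀ {ν ξ : P.Marking}, (∀ i, 0 ≤ ν i) → ν.OccursIn ξ →
          (fun i : {i // P.rowType i = r} => ν i) '' (Function.support fun i => ν i) ⊆
            (fun i : {i // P.rowType i = r} => ξ i) '' (Function.support fun i => ξ i) := by
        rintro ν ξ h0 h _ ⟨i, hi, rfl⟩
        obtain ⟨j, hrow, hj⟩ := h i (pos h0 hi)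
        exact ⟨⟨j, hrow.trans i.2⟩, by rwa [Function.mem_support, hj], hj⟩
      exact exists_perm_comp_eq_of_injOn_support (injOn hμ hμ0) (injOn hδ hδ0)
        ((image_subset hμ0 hμδ).antisymm (image_subset hδ0 hδμ))
  choose τ hτ using fiberPerm
  refine ⟨Equiv.ofFiberEquiv τ, fun i => ?_⟩
  obtain ⟨hl, hc⟩ := Prod.ext_iff.mp (Equiv.ofFiberEquiv_map τ i)
  exact ⟨hl.symm, hc.symm, (hτ _ ⟨i, rfl⟩).symm⟩

end ColoredPartition.Marking

/-! ### The bifiltration defined by kernels, images and colors -/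

section Bases

variable {n : ℕ} {F V : Type*} [Field F] [AddCommGroup V] [Module F V]
variable {C : ZMod n → Submodule F V} {P : ColoredPartition n} {b : Module.Basis P.Box F V}
variable {i : ℕ} {t : ℤ}

theorem extBasis_of_nonpos (ht : t ≤ 0) : extBasis b i t = 0 :=
  dif_neg (by omega)

theorem exists_box_of_extBasis_ne_zero (h : extBasis b i t ≠ 0) :
    ∃ p : P.Box, p.1.1 = i ∧ (p.1.2 : ℤ) = t := by
  rw [extBasis, dite_ne_right_iff] at h
  obtain ⟨hp, -⟩ := h
  exact ⟨⟨(i, t.toNat), hp⟩, rfl, Int.toNat_of_nonneg (by omega)⟩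

theorem ColoredPartition.exists_box (ht : 0 < t) (ht' : t ≤ P.len i) :
    ∃ p : P.Box, p.1.1 = i ∧ (p.1.2 : ℤ) = t :=
  ⟨⟨(i, t.toNat), by dsimp only; omega⟩, rfl, Int.toNat_of_nonneg ht.le⟩

theorem extBasis_mem (hb : IsOfType C b) (i : ℕ) (t : ℤ) :
    extBasis b i t ∈ C (P.color i + (((P.len i : ℤ) - t : ℤ) : ZMod n)) := by
  by_cases h : extBasis b i t = 0
  · rw [h]
    exact zero_mem _
  · obtain ⟨p, rfl, rfl⟩ := exists_box_of_extBasis_ne_zero h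
    rw [extBasis_eq]
    exact hb p

theorem pow_extBasis {x : NilCone C} (hx : IsJordanFor b x) (ht : t ≤ P.len i) (k : ℕ) :
    (x.1 ^ k) (extBasis b i t) = extBasis b i (t - k) := by
  rcases le_or_gt t 0 with h | h
  · rw [extBasis_of_nonpos h, extBasis_of_nonpos (by omega), map_zero]
  · obtain ⟨p, rfl, rfl⟩ := ColoredPartition.exists_box h ht
    rw [extBasis_eq, pow_apply_extBasis hx]

theorem repr_extBasis (i : ℕ) (t : ℤ) (p : P.Box) :
    b.repr (extBasis b i t) p = if p.1.1 = i ∧ (p.1.2 : ℤ) = t then 1 else 0 := by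
  by_cases h : extBasis b i t = 0
  · rw [h, map_zero, Finsupp.zero_apply, if_neg]
    rintro ⟨rfl, rfl⟩
    exact b.ne_zero p ((extBasis_eq b p).symm.trans h)
  · obtain ⟨q, rfl, rfl⟩ := exists_box_of_extBasis_ne_zero h
    rw [extBasis_eq, b.repr_self, Finsupp.single_apply]
    refine if_congr ?_ rfl rfl
    rw [Nat.cast_inj, ← Prod.ext_iff, ← Subtype.ext_iff, eq_comm]

theorem repr_markedVector (μ : P.Marking) (p : P.Box) :
    b.repr (markedVector b μ) p = if (p.1.2 : ℤ) = μ p.1.1 then 1 else 0 := by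
  simp only [markedVector, map_sum, Finsupp.finsetSum_apply, repr_extBasis, ite_and]
  rw [Finset.sum_ite_eq, if_pos]
  exact Finset.mem_range.mpr (ColoredPartition.lt_length_iff.mpr (p.2.1.trans p.2.2))

theorem repr_pow_apply {x : NilCone C} (hx : IsJordanFor b x) {k : ℕ} {p q : P.Box}
    (hrow : p.1.1 = q.1.1) (hcol : p.1.2 + k = q.1.2) (v : V) :
    b.repr ((x.1 ^ k) v) p = b.repr v q := by
  suffices b.coord p ∘ₗ (x.1 ^ k) = b.coord q from LinearMap.congr_fun this v
  refine b.ext fun r => ?_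
  simp only [LinearMap.comp_apply, Module.Basis.coord_apply]
  rw [pow_apply_extBasis hx, ← extBasis_eq b r, repr_extBasis, repr_extBasis]
  refine if_congr ?_ rfl rfl
  omega

theorem repr_pow_apply_eq_zero {x : NilCone C} (hx : IsJordanFor b x) {k : ℕ} {p : P.Box}
    (hcol : P.len p.1.1 < p.1.2 + k) (v : V) : b.repr ((x.1 ^ k) v) p = 0 := by
  suffices b.coord p ∘ₗ (x.1 ^ k) = 0 from LinearMap.congr_fun this v
  refine b.ext fun r => ?_
  simp only [LinearMap.comp_apply, Module.Basis.coord_apply, LinearMap.zero_apply]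
  rw [pow_apply_extBasis hx, repr_extBasis, if_neg]
  rintro ⟨hrow, h⟩
  have := r.2.2
  rw [← hrow] at this
  omega

theorem boxColor_eq_of_repr_ne_zero (hP : P.signature = spaceSignature C) (hb : IsOfType C b)
    {m : ZMod n} {v : V} (hv : v ∈ C m) {p : P.Box} (hp : b.repr v p ≠ 0) :
    P.boxColor p = m := by
  have hspan : C m = Submodule.span F (b '' {p | P.boxColor p = m}) := by
    rw [← color_eq_span hP hb m, Set.image_eq_range]
    rfl
  rw [hspan] at hv
  exact b.repr_support_subset_of_mem_span _ hv (Finsupp.mem_support_iff.mpr hp)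

/-- The subspace `ker x^k ∩ im x^s ∩ V_m`.  These subspaces are attached to `x` without reference
to a basis, and by `bifiltration_eq_span` each colored Jordan basis for `x` is adapted to them. -/
def bifiltration (C : ZMod n → Submodule F V) (x : Module.End F V) (k s : ℕ) (m : ZMod n) :
    Submodule F V :=
  LinearMap.ker (x ^ k) ⊓ LinearMap.range (x ^ s) ⊓ C m

/-- The boxes of color `m` in the first `k` columns that are followed by at least `s` boxes of
their row; they label the basis vectors in `bifiltration C x k s m`. -/
def ColoredPartition.bifiltrationBoxes (P : ColoredPartition n) (k s : ℕ) (m : ZMod n) :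
    Set P.Box :=
  {p | p.1.2 ≤ k ∧ p.1.2 + s ≤ P.len p.1.1 ∧ P.boxColor p = m}

theorem mem_bifiltrationBoxes_of_repr_ne_zero (hP : P.signature = spaceSignature C)
    (hb : IsOfType C b) {x : NilCone C} (hx : IsJordanFor b x) {k s : ℕ} {m : ZMod n} {v : V}
    (hv : v ∈ bifiltration C x.1 k s m) {p : P.Box} (hp : b.repr v p ≠ 0) :
    p ∈ P.bifiltrationBoxes k s m := by
  obtain ⟨⟨hker, w, rfl⟩, hm⟩ := hv
  refine ⟨?_, ?_, boxColor_eq_of_repr_ne_zero hP hb hm hp⟩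
  · by_contra! hk
    let q : P.Box := ⟨(p.1.1, p.1.2 - k), by have := p.2; dsimp only; omega⟩
    have hq : q.1.2 + k = p.1.2 := Nat.sub_add_cancel hk.le
    refine hp ((repr_pow_apply hx (p := q) (q := p) rfl hq _).symm.trans ?_)
    rw [LinearMap.mem_ker.mp hker, map_zero, Finsupp.zero_apply]
  · by_contra! hs
    exact hp (repr_pow_apply_eq_zero hx hs w)

theorem basis_mem_bifiltration (hb : IsOfType C b) {x : NilCone C} (hx : IsJordanFor b x)
    {k s : ℕ} {m : ZMod n} {p : P.Box} (hp : p ∈ P.bifiltrationBoxes k s m) :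
    b p ∈ bifiltration C x.1 k s m := by
  obtain ⟨hk, hs, rfl⟩ := hp
  refine ⟨⟨LinearMap.mem_ker.mpr ?_, extBasis b p.1.1 (p.1.2 + s), ?_⟩, hb p⟩
  · rw [pow_apply_extBasis hx, extBasis_of_nonpos (by omega)]
  · rw [pow_extBasis hx (by omega), add_sub_cancel_right, extBasis_eq]

theorem bifiltration_eq_span (hP : P.signature = spaceSignature C) (hb : IsOfType C b)
    {x : NilCone C} (hx : IsJordanFor b x) (k s : ℕ) (m : ZMod n) :
    bifiltration C x.1 k s m = Submodule.span F (b '' P.bifiltrationBoxes k s m) := by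
  refine le_antisymm (fun v hv => b.mem_span_image.mpr fun p hp => ?_) (Submodule.span_le.mpr ?_)
  · exact mem_bifiltrationBoxes_of_repr_ne_zero hP hb hx hv (Finsupp.mem_support_iff.mp hp)
  · rintro _ ⟨p, hp, rfl⟩
    exact basis_mem_bifiltration hb hx hp

theorem finrank_bifiltration (hP : P.signature = spaceSignature C) (hb : IsOfType C b)
    {x : NilCone C} (hx : IsJordanFor b x) (k s : ℕ) (m : ZMod n) :
    Module.finrank F (bifiltration C x.1 k s m) = (P.bifiltrationBoxes k s m).ncard := by
  have := Fintype.ofFinite (P.bifiltrationBoxes k s m)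
  have hli := b.linearIndependent.comp (Subtype.val : P.bifiltrationBoxes k s m → P.Box)
    Subtype.val_injective
  rw [bifiltration_eq_span hP hb hx, ← Nat.card_coe_set_eq, Nat.card_eq_fintype_card,
    ← finrank_span_eq_card hli, Set.range_comp, Subtype.range_coe]

namespace ColoredPartition

theorem ncard_rowType_eq (P : ColoredPartition n) (s : ℕ) (c : ZMod n) :
    {i | P.rowType i = (s + 1, c)}.ncard =
      (P.bifiltrationBoxes 1 s (c + s)).ncard - (P.bifiltrationBoxes 1 (s + 1) (c + s)).ncard := by
  have hsub : P.bifiltrationBoxes 1 (s + 1) (c + s) ⊆ P.bifiltrationBoxes 1 s (c + s) :=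
    fun p ⟨hk, hs, hm⟩ => ⟨hk, by omega, hm⟩
  have hinj : Set.InjOn (fun p : P.Box => p.1.1)
      (P.bifiltrationBoxes 1 s (c + s) \ P.bifiltrationBoxes 1 (s + 1) (c + s)) :=
    fun p hp q hq hpq => Subtype.ext <| Prod.ext hpq <|
      (hp.1.1.antisymm p.2.1).trans (hq.1.1.antisymm q.2.1).symm
  rw [← Set.ncard_sdiff hsub, ← hinj.ncard_image]
  congr 1
  ext i
  constructor
  · intro hi
    obtain ⟨hl, hc⟩ := Prod.ext_iff.mp hi
    dsimp only [rowType] at hl hc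
    refine ⟨⟨(i, 1), by dsimp only; omega⟩, ⟨⟨le_rfl, by dsimp only; omega, ?_⟩, ?_⟩, rfl⟩
    · simp [boxColor, hl, hc]
    · rintro ⟨-, h, -⟩
      dsimp only at h
      omega
  · rintro ⟨p, ⟨⟨hk, hs, hm⟩, hn⟩, rfl⟩
    have hcol : p.1.2 = 1 := hk.antisymm p.2.1
    have hl : P.len p.1.1 = s + 1 := by
      by_contra hl
      exact hn ⟨hk, by omega, hm⟩
    refine Prod.ext hl ?_
    simpa [rowType, boxColor, hl, hcol] using hm

end ColoredPartition

theorem exists_perm_rowType_eq_of_isJordanFor {Q : ColoredPartition n}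
    (hP : P.signature = spaceSignature C) (hQ : Q.signature = spaceSignature C)
    {b' : Module.Basis Q.Box F V} {x : NilCone C} (hb : IsOfType C b) (hx : IsJordanFor b x)
    (hb' : IsOfType C b') (hx' : IsJordanFor b' x) :
    ∃ σ : Equiv.Perm ℕ, ∀ i, P.rowType (σ i) = Q.rowType i := by
  refine ColoredPartition.exists_perm_rowType_eq fun ⟨l, c⟩ hl => ?_
  obtain ⟨s, rfl⟩ := Nat.exists_eq_succ_of_ne_zero hl
  simp only [Nat.succ_eq_add_one, ColoredPartition.ncard_rowType_eq,
    ← finrank_bifiltration hP hb hx, ← finrank_bifiltration hQ hb' hx']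

-- The basis vector of `b'` at some mark of `δ` has a nonzero coefficient at the box `(i, μ_i)`, and
-- membership in the bifiltration bounds the boxes of `b` at which it can have one.
theorem exists_dominates {Q : ColoredPartition n}
    (hP : P.signature = spaceSignature C) {b' : Module.Basis Q.Box F V} {x : NilCone C}
    (hb : IsOfType C b) (hx : IsJordanFor b x) (hb' : IsOfType C b') (hx' : IsJordanFor b' x)
    {μ : P.Marking} {δ : Q.Marking} (h : markedVector b μ = markedVector b' δ) (hi : 0 < μ i) :
    ∃ j, δ.Dominates j μ i := by
  obtain ⟨p, rfl, hp⟩ := ColoredPartition.exists_box hi (μ.2 i)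
  have hcoeff : ∑ j ∈ Finset.range Q.length, b.repr (extBasis b' j (δ j)) p ≠ 0 := by
    rw [← Finsupp.finsetSum_apply, ← map_sum, ← markedVector, ← h, repr_markedVector, if_pos hp]
    exact one_ne_zero
  obtain ⟨j, -, hj⟩ := Finset.exists_ne_zero_of_sum_ne_zero hcoeff
  obtain ⟨q, rfl, hq⟩ := exists_box_of_extBasis_ne_zero (b := b') (i := j) (t := δ j) fun h0 =>
    hj (by rw [h0, map_zero, Finsupp.zero_apply])
  rw [← hq, extBasis_eq] at hj
  obtain ⟨hk, hs, hm⟩ := mem_bifiltrationBoxes_of_repr_ne_zero hP hb hx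
    (basis_mem_bifiltration hb' hx' (p := q) ⟨le_rfl, (Nat.add_sub_of_le q.2.2).le, rfl⟩) hj
  refine ⟨q.1.1, ?_, ?_, ?_⟩
  · rw [ColoredPartition.markColor, ColoredPartition.markColor, ← hq, ← hp]
    exact hm.symm
  · omega
  · have := q.2.2
    omega

end Bases

/-! ### Row operations -/

section RowOperations

variable {n : ℕ} {F V : Type*} [Field F] [AddCommGroup V] [Module F V]
variable {C : ZMod n → Submodule F V} {P : ColoredPartition n} {b : Module.Basis P.Box F V}
variable {x : NilCone C} {i j : ℕ} {d : ℤ}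

theorem markedVector_posPart (μ : P.Marking) : markedVector b μ.posPart = markedVector b μ := by
  refine b.ext_elem fun p => ?_
  rw [repr_markedVector, repr_markedVector]
  refine if_congr ?_ rfl rfl
  have := p.2.1
  change (p.1.2 : ℤ) = max (μ p.1.1) 0 ↔ _
  omega

theorem markedVector_erase_add (μ : P.Marking) (j : ℕ) :
    markedVector b (μ.erase j) + extBasis b j (μ j) = markedVector b μ := by
  refine b.ext_elem fun p => ?_
  have hp : (p.1.2 : ℤ) ≠ 0 := by have := p.2.1; omega
  rw [map_add, Finsupp.add_apply, repr_markedVector, repr_markedVector, repr_extBasis,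
    ColoredPartition.Marking.erase_apply]
  by_cases hj : p.1.1 = j
  · rw [if_pos hj, if_neg hp, zero_add, hj]
    simp only [true_and]
  · simp only [hj, if_false, false_and, add_zero]

/-- The linear map sending row `i` of the basis to row `j`, with columns shifted to the left by
`d`, and killing the other rows. -/
noncomputable def rowShift (b : Module.Basis P.Box F V) (i j : ℕ) (d : ℤ) : Module.End F V :=
  b.constr F fun p => if p.1.1 = i then extBasis b j (p.1.2 - d) else 0

theorem rowShift_extBasis (hd : 0 ≤ d) {k : ℕ} {t : ℤ} (ht : t ≤ P.len k) :
    rowShift b i j d (extBasis b k t) = if k = i then extBasis b j (t - d) else 0 := by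
  rcases le_or_gt t 0 with h | h
  · rw [extBasis_of_nonpos h, extBasis_of_nonpos (by omega), map_zero, ite_self]
  · obtain ⟨p, rfl, rfl⟩ := ColoredPartition.exists_box h ht
    rw [extBasis_eq, rowShift, b.constr_basis]

theorem rowShift_sq (hij : i ≠ j) (hd : 0 ≤ d) (hd' : (P.len i : ℤ) - d ≤ P.len j) :
    rowShift b i j d ^ 2 = 0 := by
  refine b.ext fun p => ?_
  rw [sq, Module.End.mul_apply, ← extBasis_eq, rowShift_extBasis hd (by exact_mod_cast p.2.2)]
  split_ifs with h
  · have := p.2.2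
    rw [h] at this
    rw [rowShift_extBasis hd (by omega), if_neg hij.symm, LinearMap.zero_apply]
  · rw [map_zero, LinearMap.zero_apply]

/-- The elementary row operation that adds row `j`, shifted to the right by `d` columns, to
row `i`. -/
noncomputable def addRow (b : Module.Basis P.Box F V) (hij : i ≠ j) (hd : 0 ≤ d)
    (hd' : (P.len i : ℤ) - d ≤ P.len j) : Module.Basis P.Box F V :=
  b.map <| LinearMap.GeneralLinearGroup.toLinearEquiv
    (IsNilpotent.isUnit_one_add ⟨2, rowShift_sq (b := b) hij hd hd'⟩).unit

theorem extBasis_map (g : V ≃ₗ[F] V) (i : ℕ) (t : ℤ) :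
    extBasis (b.map g) i t = g (extBasis b i t) := by
  simp only [extBasis, apply_dite g, map_zero, Module.Basis.map_apply]

section

variable (hij : i ≠ j) (hd : 0 ≤ d) (hd' : (P.len i : ℤ) - d ≤ P.len j)

theorem extBasis_addRow {k : ℕ} {t : ℤ} (ht : t ≤ P.len k) :
    extBasis (addRow b hij hd hd') k t =
      extBasis b k t + if k = i then extBasis b j (t - d) else 0 := by
  rw [addRow, extBasis_map, ← rowShift_extBasis hd ht]
  rfl

theorem addRow_apply (p : P.Box) :
    addRow b hij hd hd' p = b p + if p.1.1 = i then extBasis b j (p.1.2 - d) else 0 := by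
  rw [← extBasis_eq, extBasis_addRow hij hd hd' (by exact_mod_cast p.2.2), extBasis_eq]

theorem isOfType_addRow (hb : IsOfType C b)
    (hc : P.color j + (((P.len j : ℤ) + d : ℤ) : ZMod n) = P.color i + (P.len i : ZMod n)) :
    IsOfType C (addRow b hij hd hd') := by
  intro p
  rw [addRow_apply]
  refine add_mem (hb p) ?_
  split_ifs with h
  · convert extBasis_mem hb j (p.1.2 - d) using 2
    rw [ColoredPartition.boxColor, h]
    push_cast at hc ⊢
    linear_combination -hc
  · exact zero_mem _

theorem isJordanFor_addRow (hx : IsJordanFor b x) : IsJordanFor (addRow b hij hd hd') x := by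
  intro p
  have hp := p.2.2
  rw [addRow_apply, extBasis_addRow hij hd hd' (by omega), map_add, hx p]
  congr 1
  split_ifs with h
  · rw [h] at hp
    have := pow_extBasis hx (i := j) (t := p.1.2 - d) (by omega) 1
    rw [pow_one] at this
    rw [this]
    congr 1
    push_cast
    ring
  · exact map_zero _

theorem markedVector_addRow {μ : P.Marking} (hi : i < P.length) :
    markedVector (addRow b hij hd hd') μ = markedVector b μ + extBasis b j (μ i - d) := by
  simp only [markedVector, extBasis_addRow hij hd hd' (μ.2 _), Finset.sum_add_distrib,
    Finset.sum_ite_eq', Finset.mem_range, if_pos hi]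

end

end RowOperations

section RowPermutations

variable {n : ℕ} {F V : Type*} [Field F] [AddCommGroup V] [Module F V]
variable {C : ZMod n → Submodule F V} {P Q : ColoredPartition n} {b : Module.Basis Q.Box F V}
variable {σ : Equiv.Perm ℕ}

/-- The bijection between the boxes of two diagrams given by a permutation of their rows. -/
def ColoredPartition.boxEquiv (hσ : ∀ i, P.rowType (σ i) = Q.rowType i) : Q.Box ≃ P.Box :=
  (σ.prodCongr (Equiv.refl ℕ)).subtypeEquiv fun p =>
    iff_of_eq (congrArg (1 ≤ p.2 ∧ p.2 ≤ ·) (congrArg Prod.fst (hσ p.1)).symm)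

variable (hσ : ∀ i, P.rowType (σ i) = Q.rowType i)

theorem ColoredPartition.boxColor_boxEquiv (q : Q.Box) :
    P.boxColor (boxEquiv hσ q) = Q.boxColor q := by
  obtain ⟨hl, hc⟩ := Prod.ext_iff.mp (hσ q.1.1)
  dsimp only [rowType] at hl hc
  rw [boxColor, boxColor, ← hl, ← hc]
  rfl

theorem extBasis_reindex_boxEquiv (i : ℕ) (t : ℤ) :
    extBasis (b.reindex (ColoredPartition.boxEquiv hσ)) (σ i) t = extBasis b i t := by
  have hl : P.len (σ i) = Q.len i := congrArg Prod.fst (hσ i)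
  simp only [extBasis, hl]
  refine dite_congr rfl (fun h => ?_) fun _ => rfl
  rw [Module.Basis.reindex_apply]
  congr 1
  exact (Equiv.symm_apply_eq _).mpr rfl

theorem IsOfType.reindex_boxEquiv (hb : IsOfType C b) :
    IsOfType C (b.reindex (ColoredPartition.boxEquiv hσ)) := by
  intro p
  obtain ⟨q, rfl⟩ := (ColoredPartition.boxEquiv hσ).surjective p
  rw [Module.Basis.reindex_apply, Equiv.symm_apply_apply, ColoredPartition.boxColor_boxEquiv]
  exact hb q

theorem IsJordanFor.reindex_boxEquiv {x : NilCone C} (hx : IsJordanFor b x) :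
    IsJordanFor (b.reindex (ColoredPartition.boxEquiv hσ)) x := by
  intro p
  obtain ⟨q, rfl⟩ := (ColoredPartition.boxEquiv hσ).surjective p
  rw [Module.Basis.reindex_apply, Equiv.symm_apply_apply, hx q]
  exact (extBasis_reindex_boxEquiv hσ _ _).symm

theorem markedVector_reindex_boxEquiv {μ : P.Marking} {γ : Q.Marking}
    (h : ∀ i, γ i = μ (σ i)) :
    markedVector (b.reindex (ColoredPartition.boxEquiv hσ)) μ = markedVector b γ := by
  refine (b.reindex (ColoredPartition.boxEquiv hσ)).ext_elem fun p => ?_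
  obtain ⟨q, rfl⟩ := (ColoredPartition.boxEquiv hσ).surjective p
  rw [repr_markedVector, Module.Basis.repr_reindex_apply, Equiv.symm_apply_apply,
    repr_markedVector, h]
  rfl

end RowPermutations

/-! ### Orbits and minimal markings -/

section Orbits

variable {n : ℕ} {F V : Type*} [Field F] [AddCommGroup V] [Module F V]
variable {C : ZMod n → Submodule F V} {P Q : ColoredPartition n} {b : Module.Basis P.Box F V}
variable {x : NilCone C} {v : V} {μ : P.Marking} {O : EnhOrbit C}

theorem isOfType_map (hb : IsOfType C b) (g : colorGroup C) : IsOfType C (b.map g.1) := fun p => by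
  rw [Module.Basis.map_apply]
  exact (g.2 _ _).2 (hb p)

theorem isJordanFor_map (hx : IsJordanFor b x) (g : colorGroup C) :
    IsJordanFor (b.map g.1) (g • x) := fun p => by
  rw [extBasis_map, Module.Basis.map_apply, ← hx p]
  exact congrArg (fun w => g.1 (x.1 w)) (g.1.symm_apply_apply (b p))

theorem markedVector_map (g : V ≃ₗ[F] V) (μ : P.Marking) :
    markedVector (b.map g) μ = g (markedVector b μ) := by
  simp only [markedVector, extBasis_map, map_sum]

variable [NeZero n] [FiniteDimensional F V] {hC : DirectSum.IsInternal C}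
variable {hP : P.signature = spaceSignature C} {hQ : Q.signature = spaceSignature C}

theorem shapeOrbit_eq_nilOrbitOf_iff :
    shapeOrbit hC P hP = nilOrbitOf C x ↔
      ∃ b : Module.Basis P.Box F V, IsOfType C b ∧ IsJordanFor b x := by
  refine ⟨fun h => ?_, fun ⟨b, hb, hx⟩ => shapeOrbit_eq hC hP hb hx⟩
  obtain ⟨⟨b, y⟩, hb, hy⟩ := exists_typedJordan hC P hP
  rw [shapeOrbit_eq hC hP hb hy] at h
  obtain ⟨g, rfl⟩ := Quotient.exact h.symm
  exact ⟨b.map g.1, isOfType_map hb g, isJordanFor_map hy g⟩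

theorem Psi_eq_enhOrbitOf_iff :
    Psi hC P hP μ = enhOrbitOf C v x ↔
      ∃ b : Module.Basis P.Box F V, IsOfType C b ∧ IsJordanFor b x ∧ markedVector b μ = v := by
  constructor
  · intro h
    obtain ⟨⟨b, y⟩, hb, hy⟩ := exists_typedJordan hC P hP
    rw [Psi_eq hC hP μ hb hy] at h
    obtain ⟨g, hg⟩ := Quotient.exact h.symm
    obtain ⟨rfl, rfl⟩ := Prod.ext_iff.mp hg
    exact ⟨b.map g.1, isOfType_map hb g, isJordanFor_map hy g, markedVector_map g.1 μ⟩
  · rintro ⟨b, hb, hx, rfl⟩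
    exact Psi_eq hC hP μ hb hx

theorem Psi_posPart (μ : P.Marking) : Psi hC P hP μ.posPart = Psi hC P hP μ := by
  obtain ⟨⟨b, x⟩, hb, hx⟩ := exists_typedJordan hC P hP
  rw [Psi_eq hC hP _ hb hx, Psi_eq hC hP _ hb hx, markedVector_posPart]

-- In the basis obtained by adding row `j`, suitably shifted, to row `i`, the mark in row `i` alone
-- stands for the sum of both marks in the old basis.
theorem Psi_erase {i j : ℕ} (hij : i ≠ j) (hi : 0 < μ i) (h : μ.Dominates i μ j) :
    Psi hC P hP (μ.erase j) = Psi hC P hP μ := by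
  obtain ⟨hc, hle, hlen⟩ := h
  obtain ⟨⟨b, x⟩, hb, hx⟩ := exists_typedJordan hC P hP
  have hd : 0 ≤ μ i - μ j := sub_nonneg.mpr hle
  have hd' : (P.len i : ℤ) - (μ i - μ j) ≤ P.len j := by omega
  have hcolor : P.color j + (((P.len j : ℤ) + (μ i - μ j) : ℤ) : ZMod n) =
      P.color i + (P.len i : ZMod n) := by
    simp only [ColoredPartition.markColor] at hc
    push_cast at hc ⊢
    linear_combination -hc
  rw [Psi_eq hC hP _ (isOfType_addRow hij hd hd' hb hcolor) (isJordanFor_addRow hij hd hd' hx),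
    Psi_eq hC hP _ hb hx, markedVector_addRow hij hd hd' (ColoredPartition.Marking.lt_length hi),
    ColoredPartition.Marking.erase_apply, if_neg hij, sub_sub_cancel, markedVector_erase_add]

theorem Psi_eq_of_rowEquivalent {γ : Q.Marking} (h : RowEquivalent P Q μ γ) :
    Psi hC P hP μ = Psi hC Q hQ γ := by
  obtain ⟨σ, hσ⟩ := h
  obtain ⟨⟨b, x⟩, hb, hx⟩ := exists_typedJordan hC Q hQ
  have hrow : ∀ i, P.rowType (σ i) = Q.rowType i := fun i =>
    (Prod.ext (hσ i).1 (hσ i).2.1).symm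
  rw [Psi_eq hC hP μ (hb.reindex_boxEquiv hrow) (hx.reindex_boxEquiv hrow), Psi_eq hC hQ γ hb hx,
    markedVector_reindex_boxEquiv hrow fun i => (hσ i).2.2]

theorem exists_rowEquivalent_of_projOrbit_eq (γ : Q.Marking)
    (h : projOrbit (Psi hC Q hQ γ) = shapeOrbit hC P hP) :
    ∃ μ : P.Marking, RowEquivalent P Q μ γ := by
  obtain ⟨⟨b', x⟩, hb', hx'⟩ := exists_typedJordan hC Q hQ
  rw [Psi_eq hC hQ γ hb' hx', eq_comm] at h
  obtain ⟨b, hb, hx⟩ := shapeOrbit_eq_nilOrbitOf_iff.mp h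
  obtain ⟨σ, hσ⟩ := exists_perm_rowType_eq_of_isJordanFor hP hQ hb hx hb' hx'
  have hlen : ∀ i, Q.len (σ.symm i) = P.len i := fun i =>
    (congrArg Prod.fst (hσ (σ.symm i))).symm.trans (congrArg P.len (σ.apply_symm_apply i))
  refine ⟨⟨fun i => γ (σ.symm i), fun i => hlen i ▸ γ.2 _⟩, σ, fun i => ?_⟩
  obtain ⟨hl, hc⟩ := Prod.ext_iff.mp (hσ i)
  exact ⟨hl.symm, hc.symm, congrArg γ.1 (σ.symm_apply_apply i).symm⟩

theorem markingsOf_nonempty (hO : O ∈ psiImage hC) (hPO : projOrbit O = shapeOrbit hC P hP) :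
    (markingsOf hC P hP O).Nonempty := by
  obtain ⟨Q, hQ, γ, rfl⟩ := hO
  obtain ⟨μ, hμ⟩ := exists_rowEquivalent_of_projOrbit_eq γ hPO
  exact ⟨μ.posPart, (Psi_posPart μ).trans (Psi_eq_of_rowEquivalent hμ), fun i => le_max_right _ _⟩

theorem finite_markingsOf : (markingsOf hC P hP O).Finite :=
  ColoredPartition.Marking.finite_setOf_nonneg.subset fun _ => And.right

theorem exists_isMinimalMarking_le (hμ : μ ∈ markingsOf hC P hP O) :
    ∃ δ ≤ μ, IsMinimalMarking hC P hP O δ := by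
  obtain ⟨δ, hle, hδ⟩ := finite_markingsOf.exists_le_minimal hμ
  exact ⟨δ, hle, hδ.1, fun ν hν h => le_antisymm h (hδ.2 hν h)⟩

theorem IsMinimalMarking.isStrict (h : IsMinimalMarking hC P hP O μ) : μ.IsStrict := by
  refine ColoredPartition.Marking.isStrict_of_forall_dominates fun i j hi hj hdom => ?_
  by_contra hij
  have hle : μ.erase j ≤ μ := fun k => by
    change μ.erase j k ≤ μ k
    rw [ColoredPartition.Marking.erase_apply]
    split_ifs
    · exact h.1.2 k
    · exact le_rfl
  have hnonneg : ∀ k, 0 ≤ μ.erase j k := fun k => by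
    rw [ColoredPartition.Marking.erase_apply]
    split_ifs
    · exact le_rfl
    · exact h.1.2 k
  have heq := h.2 (μ.erase j) ⟨(Psi_erase hij hi hdom).trans h.1.1, hnonneg⟩ hle
  have := ColoredPartition.Marking.erase_apply μ j j
  rw [heq, if_pos rfl] at this
  exact hj.ne' this

end Orbits

namespace ColoredPartition.Marking.IsStrict

variable {n : ℕ} [NeZero n] {F V : Type*} [Field F] [AddCommGroup V] [Module F V]
  [FiniteDimensional F V] {C : ZMod n → Submodule F V} {hC : DirectSum.IsInternal C}
  {P Q : ColoredPartition n} {hP : P.signature = spaceSignature C}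
  {hQ : Q.signature = spaceSignature C} {O : EnhOrbit C} {μ : P.Marking}

-- Going from `μ` to `δ` and back, each positive mark of `μ` is dominated by a mark of `μ`, which
-- by strictness is the same one; so all inequalities in between are equalities.
theorem occursIn_of_Psi_eq {δ : Q.Marking} (hμ : μ.IsStrict)
    (h : Psi hC P hP μ = Psi hC Q hQ δ) : μ.OccursIn δ := by
  intro i hi
  obtain ⟨⟨b, x⟩, hb, hx⟩ := exists_typedJordan hC P hP
  rw [Psi_eq hC hP μ hb hx, eq_comm] at h
  obtain ⟨b', hb', hx', hvec⟩ := Psi_eq_enhOrbitOf_iff.mp h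
  obtain ⟨j, hj⟩ := exists_dominates hP hb hx hb' hx' hvec.symm hi
  obtain ⟨k, hk⟩ := exists_dominates hQ hb' hx' hb hx hvec (hi.trans_le hj.2.1)
  obtain rfl := hμ.eq_of_dominates hi (hk.trans hj)
  exact ⟨j, hj.rowType_eq_and_eq hk⟩

theorem isMinimalMarking (hμ : μ.IsStrict) (hμO : μ ∈ markingsOf hC P hP O) :
    IsMinimalMarking hC P hP O μ :=
  ⟨hμO, fun _ hδ => (hμ.occursIn_of_Psi_eq (hμO.1.trans hδ.1.symm)).eq_of_le hμ hδ.2⟩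

end ColoredPartition.Marking.IsStrict

theorem IsMinimalMarking.rowEquivalent {n : ℕ} [NeZero n] {F V : Type*} [Field F]
    [AddCommGroup V] [Module F V] [FiniteDimensional F V] {C : ZMod n → Submodule F V}
    {hC : DirectSum.IsInternal C} {P : ColoredPartition n} {hP : P.signature = spaceSignature C}
    {O : EnhOrbit C} {μ δ : P.Marking} (hμ : IsMinimalMarking hC P hP O μ)
    (hδ : IsMinimalMarking hC P hP O δ) : RowEquivalent P P μ δ :=
  hμ.isStrict.rowEquivalent hδ.isStrict hμ.1.2 hδ.1.2
    (hμ.isStrict.occursIn_of_Psi_eq (hμ.1.1.trans hδ.1.1.symm))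
    (hδ.isStrict.occursIn_of_Psi_eq (hδ.1.1.trans hμ.1.1.symm))

end ColoredCone

open ColoredCone in
theorem mainTheorem8 {n : ℕ} [NeZero n] {F V : Type*} [Field F] [AddCommGroup V] [Module F V]
    [FiniteDimensional F V] (C : ZMod n → Submodule F V) (hC : DirectSum.IsInternal C)
    (O : EnhOrbit C) (hO : O ∈ psiImage hC)
    (P : ColoredPartition n) (hP : P.signature = spaceSignature C)
    (hPO : projOrbit O = shapeOrbit hC P hP) :
    (∃ μ : P.Marking, IsMinimalMarking hC P hP O μ) ∧
    (∀ μ ∈ markingsOf hC P hP O, ∃ δ ≤ μ, IsMinimalMarking hC P hP O δ) ∧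
    (∀ μ δ : P.Marking, IsMinimalMarking hC P hP O μ → IsMinimalMarking hC P hP O δ →
      RowEquivalent P P μ δ) ∧
    (∀ μ ∈ markingsOf hC P hP O,
      (IsMinimalMarking hC P hP O μ ↔
        ∀ i j : ℕ, i < j → 0 < μ i → 0 < μ j → P.markColor μ j = P.markColor μ i →
          μ j < μ i ∧ (P.len j : ℤ) - μ j < (P.len i : ℤ) - μ i)) := by
  obtain ⟨μ₀, hμ₀⟩ := markingsOf_nonempty hO hPO
  obtain ⟨δ₀, -, hδ₀⟩ := exists_isMinimalMarking_le hμ₀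
  exact ⟨⟨δ₀, hδ₀⟩, fun _ => exists_isMinimalMarking_le, fun _ _ => IsMinimalMarking.rowEquivalent,
    fun _ hμ => ⟨IsMinimalMarking.isStrict, fun h =>
      ColoredPartition.Marking.IsStrict.isMinimalMarking h hμ⟩⟩
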